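/- A framework $(G,p)$ in $\mathbb R^d$ consists of a finite simple graph $G=(V,E)$ with $n$ vertices and a configuration $p:V\to\mathbb R^d$. It is generic if the $nd$ coordinates of the points $p(i)$ are algebraically independent over $\mathbb Q$, and in general position if no $d+1$ of the points are affinely dependent. Frameworks $(G,p)$ and $(G,q)$, possibly in spaces of different dimension, are equivalent if $\|p_i-p_j\|=\|q_i-q_j\|$ for all edges $ij$, and congruent if this holds for all pairs of vertices $i,j$. For $D\ge d$, a framework $(G,p)$ in $\mathbb R^d$ is globally rigid in $\mathbb R^D$ if every framework $(G,q)$ in $\mathbb R^D$ equivalent to it is congruent to it; it is universally rigid if this holds for every $D\ge d$. An equilibrium stress of $(G,p)$ is a vector $\omega\in\mathbb R^E$ (put $\omega_{ij}=0$ for $ij\notin E$) with $\sum_{j\ne i}\omega_{ij}(p_i-p_j)=0$ for every vertex $i$; its stress matrix $\Omega(\omega)$ is the symmetric $n\times n$ matrix with off-diagonal entries $-\omega_{ij}$ and diagonal entries $\sum_j\omega_{ij}$. The framework $(G,p)$ in $\mathbb R^d$ is super stable if it has an equilibrium stress $\omega$ such that $\Omega(\omega)$ is positive semidefinite of rank $n-d-1$,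 and there is no non-zero symmetric $d\times d$ matrix $Q$ with $(p_i-p_j)^{t}Q(p_i-p_j)=0$ for all edges $ij$. Two configurations $p,q:V\to\mathbb R^1$ have the same vertex order if $p_i<p_j\iff q_i<q_j$ for all $i,j\in V$. Theorem. Let $T=K_3\times K_2$ (Cartesian product) be the triangular prism. There are generic frameworks $(T,p)$ and $(T,q)$ in $\mathbb R^1$ with the same vertex order such that $(T,p)$ is super stable and universally rigid, while $(T,q)$ is not globally rigid in $\mathbb R^2$, and hence is neither universally rigid nor super stable. Consequently: (1) neither universal rigidity nor super stability of generic frameworks of $T$ in $\mathbb R^1$ is determined by the vertex order: each of these properties can hold for one and fail for the other of two generic frameworks of $T$ on the line with the same vertex order; (2) it is not true that for every finite simple graph $G$ and all general position frameworks $(G,p)$, $(G,q)$ in $\mathbb R^1$ with the same vertex order, $(G,p)$ is universally rigid if and only if $(G,q)$ is. That is, the answer to the question of Jordán and Nguyen, whether the universal rigidity of a general position framework in $\mathbb R^1$ depends only on the ordering of the vertices on the line, is negative. -/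

import Mathlib

open scoped Matrix

namespace BarJoint

/-- Euclidean `d`-space. -/
abbrev Space (d : ℕ) : Type := EuclideanSpace ℝ (Fin d)

variable {V : Type*}

/-- The frameworks `(G, p)` and `(G, q)`, possibly in spaces of different dimension, have the same
edge lengths. -/
def Equivalent (G : SimpleGraph V) {d D : ℕ} (p : V → Space d) (q : V → Space D) : Prop :=
  ∀ i j, G.Adj i j → dist (p i) (p j) = dist (q i) (q j)

/-- The configurations `p` and `q` have the same pairwise distances. -/
def Congruent {d D : ℕ} (p : V → Space d) (q : V → Space D) : Prop :=
  ∀ i j, dist (p i) (p j) = dist (q i) (q j)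

/-- `(G, p)` is globally rigid in `ℝ^D`: every framework in `ℝ^D` equivalent to `(G, p)` is congruent
to it. For `d ≤ D` this is global rigidity of `(G, p)` viewed in `ℝ^D` through any isometric
embedding `ℝ^d → ℝ^D`, since only the mutual distances of the points of `p` matter. -/
def IsGloballyRigidIn (G : SimpleGraph V) {d : ℕ} (p : V → Space d) (D : ℕ) : Prop :=
  ∀ q : V → Space D, Equivalent G p q → Congruent p q

/-- `(G, p)` in `ℝ^d` is universally rigid: it is globally rigid in `ℝ^D` for every `D ≥ d`. -/
def IsUniversallyRigid (G : SimpleGraph V) {d : ℕ} (p : V → Space d) : Prop :=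
  ∀ D, d ≤ D → IsGloballyRigidIn G p D

/-- The coordinates of all the points are algebraically independent over `ℚ`. -/
def IsGeneric {d : ℕ} (p : V → Space d) : Prop :=
  AlgebraicIndependent ℚ (fun x : V × Fin d => p x.1 x.2)

/-- General position in `ℝ^d`: no `d + 1` points are affinely dependent. -/
def IsGeneralPosition {d : ℕ} (p : V → Space d) : Prop :=
  ∀ f : Fin (d + 1) → V, Function.Injective f → AffineIndependent ℝ (p ∘ f)

/-- `ω` is an equilibrium stress of `(G, p)`: a weight on the edges, written as a symmetric function
of two vertices that vanishes on non-adjacent pairs, in equilibrium at each vertex. -/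
structure IsEquilibriumStress [Fintype V] (G : SimpleGraph V) {d : ℕ} (p : V → Space d)
    (ω : V → V → ℝ) : Prop where
  symm : ∀ i j, ω i j = ω j i
  support : ∀ i j, ¬ G.Adj i j → ω i j = 0
  equilibrium : ∀ i, ∑ j, ω i j • (p i - p j) = 0

/-- The stress matrix: off-diagonal entries `-ω i j`, diagonal entries `∑ j, ω i j`. -/
def stressMatrix [Fintype V] [DecidableEq V] (ω : V → V → ℝ) : Matrix V V ℝ :=
  Matrix.of fun i j => if i = j then ∑ k, ω i k else -ω i j

/-- The edge directions of `(G, p)` lie on a conic at infinity. -/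
def EdgesOnConic (G : SimpleGraph V) {d : ℕ} (p : V → Space d) : Prop :=
  ∃ Q : Matrix (Fin d) (Fin d) ℝ, Q ≠ 0 ∧ Q.IsSymm ∧
    ∀ i j, G.Adj i j → (p i - p j).ofLp ⬝ᵥ (Q *ᵥ (p i - p j).ofLp) = 0

/-- `(G, p)` is super stable in `ℝ^d`: it has an equilibrium stress whose stress matrix is positive
semidefinite of rank `n - d - 1`, and its edge directions do not lie on a conic at infinity. -/
def IsSuperStable [Fintype V] [DecidableEq V] (G : SimpleGraph V) {d : ℕ} (p : V → Space d) : Prop :=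
  (∃ ω : V → V → ℝ, IsEquilibriumStress G p ω ∧ (stressMatrix ω).PosSemidef ∧
    (stressMatrix ω).rank + d + 1 = Fintype.card V) ∧
  ¬ EdgesOnConic G p

/-- Two configurations on the line have the same left-to-right order of the (labelled) vertices. -/
def SameOrder (p q : V → Space 1) : Prop :=
  ∀ i j, p i 0 < p j 0 ↔ q i 0 < q j 0

/-- The triangular prism, the Cartesian product of `K_3` and `K_2`. -/
def prism : SimpleGraph (Fin 3 × Fin 2) :=
  SimpleGraph.boxProd (SimpleGraph.completeGraph (Fin 3)) (SimpleGraph.completeGraph (Fin 2))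

end BarJoint

/-!
All conditions involved are open in the configuration and generic configurations are dense, so it is
enough to find one rational configuration of each kind, the two having the same vertex order, and to
show that the two properties persist nearby.

*Super stability.* On the line, equilibrium stresses are circulations: if `f` is a flow on the oriented
edges conserved at every vertex, then `ω i j = f i j / (x i - x j)` is an equilibrium stress of the
framework with coordinates `x`, and it depends continuously on `x`. Its energy is invariant under adding
affine functions of the position to a displacement. So the stress matrix is positive semidefinite of
rank `n - 2` as soon as the energy is positive on the unit sphere of the displacements that vanish at
two chosen vertices, and compactness of the sphere makes this an open condition in `x`
(`eventually_isSuperStable_onLine`). One circulation on the prism, with triangles at `0, 2, 6` and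
`1, 5, 7`, has positive energy by an explicit sum of squares (`stressEnergy_prismFlow_pos`).
Super stability implies universal rigidity (`IsSuperStable.isUniversallyRigid`).

*Flexibility in the plane.* Let the triangles of the prism have coordinates `aᵢ` and `bᵢ`, and let
`S + A a - B b + C a b = 0` be the curve through the points `(aᵢ, bᵢ)`. In an equivalent framework each
triangle is still collinear. If the triangles are put on two lines of directions `e` and `f` in the
plane, their origins differing by `w`, then the squared distance of points with coordinates `a` and `b`
exceeds `(a - b)²` by `|w|² + 2 a (w · e) - 2 b (w · f) + 2 a b (1 - e · f)`. So the lengths of the rungs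
are kept if `|w|² / 2`, `w · e`, `w · f`, `1 - e · f` are a common multiple of `S`, `A`, `B`, `C`. Such
`w`, `e`, `f` exist in the plane when `4 S C > (A - B)²`, that is, when the curve does not meet the line
`a = b`, not even at infinity (`not_isGloballyRigidIn_two_of_hyperbola`). This is the case for
triangles at `-6, 0, 6` and `-2, 3, 18`, whose vertices are in the same order as before.
-/

open scoped Matrix

namespace BarJoint

open Filter Topology

/-! ### Density of generic configurations -/

/-- The coordinates in `s` are perturbed one at a time: the numbers algebraic over the coordinates
already treated are countable, so they leave out a dense set of values for the next one. -/
theorem exists_mem_algebraicIndepOn {ι : Type*} (U : Set (ι → ℝ)) (hU : IsOpen U)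
    (hne : U.Nonempty) (s : Finset ι) :
    ∃ x ∈ U, AlgebraicIndepOn ℚ x (s : Set ι) := by
  classical
  induction s using Finset.induction_on with
  | empty =>
    obtain ⟨x, hx⟩ := hne
    refine ⟨x, hx, ?_⟩
    rw [Finset.coe_empty]
    exact algebraicIndependent_empty_type_iff.2 (algebraMap ℚ ℝ).injective
  | insert i s hi ih =>
    obtain ⟨x, hx, hind⟩ := ih
    have hcount : {t : ℝ | IsAlgebraic (Algebra.adjoin ℚ (x '' (s : Set ι))) t}.Countable := by
      have : Countable (Algebra.adjoin ℚ (x '' (s : Set ι))) := by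
        rw [← Cardinal.mk_le_aleph0_iff]
        refine (Algebra.cardinalMk_adjoin_le ℚ _).trans ?_
        simp
      exact Algebraic.countable _ _
    obtain ⟨t, ht, htU⟩ := (hcount.dense_compl ℝ).exists_mem_open
      (hU.preimage (continuous_const.update i continuous_id : Continuous (Function.update x i)))
      ⟨x i, by simpa using hx⟩
    have himage : Function.update x i t '' (s : Set ι) = x '' (s : Set ι) :=
      Set.image_congr fun j hj => Function.update_of_ne (by rintro rfl; exact hi hj) _ _
    refine ⟨Function.update x i t, htU, ?_⟩
    rw [Finset.coe_insert]
    refine AlgebraicIndepOn.insert ?_ ?_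
    · have heq : (fun j : (s : Set ι) => Function.update x i t j) = fun j : (s : Set ι) => x j :=
        funext fun j => Function.update_of_ne (by rintro h; exact hi (h ▸ j.2)) _ _
      change AlgebraicIndependent ℚ _
      rw [heq]
      exact hind
    · rw [himage, Function.update_self]
      exact ht

theorem dense_algebraicIndependent (ι : Type*) [Finite ι] :
    Dense {x : ι → ℝ | AlgebraicIndependent ℚ x} := by
  have := Fintype.ofFinite ι
  refine dense_iff_inter_open.2 fun U hU hne => ?_
  obtain ⟨x, hxU, hx⟩ := exists_mem_algebraicIndepOn U hU hne Finset.univ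
  refine ⟨x, hxU, ?_⟩
  rw [Finset.coe_univ] at hx
  exact hx.comp (fun i => (⟨i, trivial⟩ : (Set.univ : Set ι))) fun i j h => congrArg Subtype.val h

/-! ### Frameworks on the line -/

/-- The framework on the line whose vertices have the given real coordinates. -/
def onLine (x : V → ℝ) : V → Space 1 := fun v => WithLp.toLp 2 fun _ => x v

@[simp]
theorem onLine_apply (x : V → ℝ) (v : V) (k : Fin 1) : onLine x v k = x v := rfl

theorem dist_onLine (x : V → ℝ) (u v : V) : dist (onLine x u) (onLine x v) = |x u - x v| := by
  simp [EuclideanSpace.dist_eq, Real.dist_eq, Real.sqrt_sq_eq_abs]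

theorem isGeneric_onLine {x : V → ℝ} (hx : AlgebraicIndependent ℚ x) : IsGeneric (onLine x) :=
  hx.comp (fun v : V × Fin 1 => v.1) fun _ _ h => Prod.ext h (Subsingleton.elim _ _)

theorem IsGeneric.isGeneralPosition {p : V → Space 1} (hp : IsGeneric p) :
    IsGeneralPosition p := by
  intro f hf
  have hne : p (f 0) ≠ p (f 1) := fun h => by
    have := congrArg Prod.fst
      (AlgebraicIndependent.injective hp (a₁ := (f 0, 0)) (a₂ := (f 1, 0)) (congrArg (· 0) h))
    exact absurd (hf this) (by decide)
  convert! affineIndependent_of_ne ℝ hne using 1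
  ext i : 1
  fin_cases i <;> rfl

/-! ### Stress matrices and Connelly's theorem on the line -/

section StressMatrix

variable [Fintype V]

/-- The energy of the stress `ω` on the line, with each pair of vertices counted twice: this is twice
the quadratic form of the stress matrix. -/
def stressEnergy (ω : V → V → ℝ) (z : V → ℝ) : ℝ := ∑ i, ∑ j, ω i j * (z i - z j) ^ 2

variable {G : SimpleGraph V} {d : ℕ} {p : V → Space d} {ω : V → V → ℝ}

theorem stressMatrix_mulVec_apply [DecidableEq V] (hω : ∀ i, ω i i = 0) (z : V → ℝ) (i : V) :
    (stressMatrix ω *ᵥ z) i = ∑ j, ω i j * (z i - z j) := by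
  have h : ∀ j, stressMatrix ω i j * z j
      = (if i = j then (∑ k, ω i k) * z i else 0) - ω i j * z j := by
    intro j
    by_cases hij : i = j
    · subst hij; simp [stressMatrix, hω]
    · simp [stressMatrix, hij]
  simp only [Matrix.mulVec, dotProduct, h, Finset.sum_sub_distrib, mul_sub, Finset.sum_ite_eq,
    Finset.mem_univ, if_true, Finset.sum_mul]

theorem IsEquilibriumStress.self_eq_zero (h : IsEquilibriumStress G p ω) (i : V) : ω i i = 0 :=
  h.support i i (G.loopless.irrefl i)

theorem two_mul_dotProduct_stressMatrix [DecidableEq V] (hsymm : ∀ i j, ω i j = ω j i)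
    (hω : ∀ i, ω i i = 0) (z : V → ℝ) :
    2 * (star z ⬝ᵥ (stressMatrix ω *ᵥ z)) = stressEnergy ω z := by
  have h₁ : star z ⬝ᵥ (stressMatrix ω *ᵥ z) = ∑ i, ∑ j, ω i j * (z i * (z i - z j)) := by
    simp only [dotProduct, stressMatrix_mulVec_apply hω, Finset.mul_sum, star_trivial]
    exact Finset.sum_congr rfl fun i _ => Finset.sum_congr rfl fun j _ => by ring
  have h₂ : star z ⬝ᵥ (stressMatrix ω *ᵥ z) = ∑ i, ∑ j, ω i j * (z j * (z j - z i)) := by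
    rw [h₁, Finset.sum_comm]
    exact Finset.sum_congr rfl fun i _ => Finset.sum_congr rfl fun j _ => by rw [hsymm]
  rw [two_mul]
  nth_rw 1 [h₁]
  rw [h₂]
  simp only [stressEnergy, ← Finset.sum_add_distrib]
  exact Finset.sum_congr rfl fun i _ => Finset.sum_congr rfl fun j _ => by ring

theorem isHermitian_stressMatrix [DecidableEq V] (hsymm : ∀ i j, ω i j = ω j i) :
    (stressMatrix ω).IsHermitian := by
  ext i j
  by_cases hij : i = j
  · subst hij; simp
  · simp [stressMatrix, hij, Ne.symm hij, hsymm i j]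

/-- The affine functions of the position are in the kernel of the stress matrix. -/
theorem IsEquilibriumStress.stressMatrix_mulVec_affine [DecidableEq V]
    (h : IsEquilibriumStress G p ω) (k : Fin d) (a b : ℝ) :
    stressMatrix ω *ᵥ (fun v => a + b * p v k) = 0 := by
  ext i
  have := congrArg (b * · k) (h.equilibrium i)
  simp only [WithLp.ofLp_sum, Finset.sum_apply, PiLp.smul_apply, PiLp.sub_apply, smul_eq_mul,
    PiLp.zero_apply, mul_zero, Finset.mul_sum] at this
  rw [stressMatrix_mulVec_apply h.self_eq_zero, Pi.zero_apply, ← this]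
  exact Finset.sum_congr rfl fun j _ => by ring

theorem exists_affine_interpolation {x₁ x₂ : ℝ} (h : x₁ ≠ x₂) (y₁ y₂ : ℝ) :
    ∃ a b : ℝ, a + b * x₁ = y₁ ∧ a + b * x₂ = y₂ := by
  have hd : x₂ - x₁ ≠ 0 := sub_ne_zero.2 h.symm
  refine ⟨y₁ - (y₂ - y₁) / (x₂ - x₁) * x₁, (y₂ - y₁) / (x₂ - x₁), by ring, ?_⟩
  field_simp
  ring

/-- The kernel of a stress matrix of rank `n - 2` on the line consists of the affine functions of the
position. -/
theorem IsEquilibriumStress.exists_affine_of_mulVec_eq_zero [DecidableEq V] {p : V → Space 1}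
    (h : IsEquilibriumStress G p ω) (hrank : (stressMatrix ω).rank + 2 = Fintype.card V)
    {u v : V} (huv : p u 0 ≠ p v 0) {z : V → ℝ} (hz : stressMatrix ω *ᵥ z = 0) :
    ∃ a b : ℝ, ∀ i, z i = a + b * p i 0 := by
  let K := LinearMap.ker (stressMatrix ω).mulVecLin
  have hK : Module.finrank ℝ K = 2 := by
    have := (stressMatrix ω).mulVecLin.finrank_range_add_finrank_ker
    rw [Module.finrank_fintype_fun_eq_card] at this
    have hr : (stressMatrix ω).rank = Module.finrank ℝ (LinearMap.range (stressMatrix ω).mulVecLin) :=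
      rfl
    change Module.finrank ℝ (LinearMap.ker (stressMatrix ω).mulVecLin) = 2
    omega
  -- Evaluation at `u` and `v` is onto `ℝ²` already on affine functions, hence injective on the kernel.
  let ev : K →ₗ[ℝ] (Fin 2 → ℝ) :=
    LinearMap.pi ![(LinearMap.proj u).comp K.subtype, (LinearMap.proj v).comp K.subtype]
  have hev0 (y : K) : ev y 0 = y.1 u := rfl
  have hev1 (y : K) : ev y 1 = y.1 v := rfl
  have hmem (a b : ℝ) : (fun i => a + b * p i 0) ∈ K := by
    simpa [K] using h.stressMatrix_mulVec_affine 0 a b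
  have hsurj : Function.Surjective ev := fun y => by
    obtain ⟨a, b, h0, h1⟩ := exists_affine_interpolation huv (y 0) (y 1)
    refine ⟨⟨_, hmem a b⟩, ?_⟩
    ext i
    fin_cases i
    · exact h0
    · exact h1
  have hinj : Function.Injective ev :=
    (LinearMap.injective_iff_surjective_of_finrank_eq_finrank (by simp [hK])).2 hsurj
  obtain ⟨a, b, h0, h1⟩ := exists_affine_interpolation huv (z u) (z v)
  have hzK : z ∈ K := by simpa [K] using hz
  have : (⟨z, hzK⟩ : K) = ⟨_, hmem a b⟩ := hinj <| by
    ext i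
    fin_cases i
    · exact h0.symm
    · exact h1.symm
  exact ⟨a, b, fun i => congrFun (congrArg Subtype.val this) i⟩

/-- Connelly's theorem for frameworks on the line. In an equivalent framework in `ℝ^D` the energies of
the coordinates add up to the energy of `p`, which is zero, so each coordinate is in the kernel of the
stress matrix. It is thus an affine function of the position on the line, and the length of one edge
of `p` forces the resulting affine map to be isometric. -/
theorem IsSuperStable.isUniversallyRigid [DecidableEq V] {p : V → Space 1}
    (hp : IsSuperStable G p) : IsUniversallyRigid G p := by
  obtain ⟨⟨ω, hω, hpsd, hrank⟩, hconic⟩ := hp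
  intro D _ q hq
  obtain ⟨u, v, huv, hne⟩ : ∃ u v, G.Adj u v ∧ p u 0 ≠ p v 0 := by
    by_contra! hcon
    exact hconic ⟨1, one_ne_zero, Matrix.isSymm_one, fun i j hij => by
      simp [dotProduct, hcon i j hij]⟩
  have hsum : ∑ k, stressEnergy ω (fun i => q i k) = stressEnergy ω (fun i => p i 0) := by
    simp only [stressEnergy]
    rw [Finset.sum_comm]
    refine Finset.sum_congr rfl fun i _ => ?_
    rw [Finset.sum_comm]
    refine Finset.sum_congr rfl fun j _ => ?_
    rw [← Finset.mul_sum]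
    by_cases hij : G.Adj i j
    · have := congrArg (· ^ 2) (hq i j hij)
      simp only [EuclideanSpace.dist_sq_eq, Real.dist_eq, sq_abs, Fin.sum_univ_one] at this
      simp [this]
    · simp [hω.support i j hij]
  have hzero : stressEnergy ω (fun i => p i 0) = 0 := by
    rw [← two_mul_dotProduct_stressMatrix hω.symm hω.self_eq_zero]
    have := hω.stressMatrix_mulVec_affine 0 0 1
    simp only [zero_add, one_mul] at this
    simp [this]
  have hnonneg (k : Fin D) : 0 ≤ stressEnergy ω (fun i => q i k) := by
    rw [← two_mul_dotProduct_stressMatrix hω.symm hω.self_eq_zero]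
    exact mul_nonneg zero_le_two (hpsd.dotProduct_mulVec_nonneg _)
  have haff (k : Fin D) : ∃ a b : ℝ, ∀ i, q i k = a + b * p i 0 := by
    refine hω.exists_affine_of_mulVec_eq_zero hrank hne
      ((hpsd.dotProduct_mulVec_zero_iff _).1 ?_)
    have := (Finset.sum_eq_zero_iff_of_nonneg fun k _ => hnonneg k).1 (hsum.trans hzero) k
      (Finset.mem_univ k)
    rw [← two_mul_dotProduct_stressMatrix hω.symm hω.self_eq_zero] at this
    linarith
  choose a b hab using haff
  have hdist (i j : V) : dist (q i) (q j) ^ 2 = (∑ k, b k ^ 2) * dist (p i) (p j) ^ 2 := by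
    simp only [EuclideanSpace.dist_sq_eq, Real.dist_eq, sq_abs, Fin.sum_univ_one, hab,
      Finset.sum_mul]
    exact Finset.sum_congr rfl fun k _ => by ring
  have hb : ∑ k, b k ^ 2 = 1 := by
    have h := hdist u v
    rw [← hq u v huv] at h
    have hpos : dist (p u) (p v) ^ 2 ≠ 0 :=
      pow_ne_zero 2 (dist_ne_zero.2 fun h => hne (congrArg (· 0) h))
    exact mul_right_cancel₀ hpos (by rw [← h, one_mul])
  intro i j
  have h := hdist i j
  rw [hb, one_mul] at h
  exact ((pow_left_inj₀ dist_nonneg dist_nonneg two_ne_zero).1 h).symm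

end StressMatrix

/-! ### A criterion for super stability on the line -/

section Perturbation

variable {G : SimpleGraph V}

theorem not_edgesOnConic_onLine {x : V → ℝ} {u v : V} (huv : G.Adj u v) (hne : x u ≠ x v) :
    ¬ EdgesOnConic G (onLine x) := by
  rintro ⟨Q, hQ, -, h⟩
  have h := h u v huv
  simp only [dotProduct, Matrix.mulVec, Fin.sum_univ_one, WithLp.ofLp_sub, Pi.sub_apply,
    onLine_apply, mul_eq_zero, sub_eq_zero, hne, false_or, or_false] at h
  refine hQ (Matrix.ext fun i j => ?_)
  rwa [Subsingleton.elim i 0, Subsingleton.elim j 0]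

theorem eventually_lt {x₀ : V → ℝ} {u v : V} (h : x₀ u < x₀ v) : ∀ᶠ x in 𝓝 x₀, x u < x v :=
  (continuousAt_apply u x₀).eventually_lt (continuousAt_apply v x₀) h

theorem eventually_sameOrder [Finite V] {x₀ : V → ℝ} (h₀ : Function.Injective x₀) :
    ∀ᶠ x in 𝓝 x₀, SameOrder (onLine x) (onLine x₀) := by
  have h : ∀ᶠ x in 𝓝 x₀, ∀ u v, x₀ u < x₀ v → x u < x v := by
    simp only [eventually_all]
    exact fun u v h => eventually_lt h
  filter_upwards [h] with x hx u v
  refine ⟨fun huv => ?_, hx u v⟩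
  by_contra hcon
  rcases (not_lt.1 hcon).lt_or_eq with hlt | heq
  · exact lt_asymm huv (hx v u hlt)
  · exact huv.ne (by rw [h₀ heq])

theorem SameOrder.injective {x y : V → ℝ} (h : SameOrder (onLine x) (onLine y))
    (hy : Function.Injective y) : Function.Injective x := by
  intro u v huv
  by_contra hne
  rcases lt_or_gt_of_ne (hy.ne hne) with hlt | hlt
  · exact ((h u v).2 hlt).ne huv
  · exact ((h v u).2 hlt).ne huv.symm

variable [Fintype V]

/-- Subtracting an affine function of the position does not change the energy of a displacement, so
that it is enough to test the stress on displacements which fix two vertices `s` and `t`. -/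
theorem IsEquilibriumStress.isSuperStable_onLine [DecidableEq V] {x : V → ℝ} {ω : V → V → ℝ}
    (h : IsEquilibriumStress G (onLine x) ω) {u v s t : V} (huv : G.Adj u v) (hne : x u ≠ x v)
    (hst : x s ≠ x t)
    (hpos : ∀ z : V → ℝ, z s = 0 → z t = 0 → z ≠ 0 → 0 < stressEnergy ω z) :
    IsSuperStable G (onLine x) := by
  let M := stressMatrix ω
  have hker (a b : ℝ) : M *ᵥ (fun i => a + b * x i) = 0 := h.stressMatrix_mulVec_affine 0 a b
  have hherm : M.IsHermitian := isHermitian_stressMatrix h.symm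
  have henergy (z : V → ℝ) : 2 * (star z ⬝ᵥ (M *ᵥ z)) = stressEnergy ω z :=
    two_mul_dotProduct_stressMatrix h.symm h.self_eq_zero z
  have hpsd : M.PosSemidef := by
    refine .of_dotProduct_mulVec_nonneg hherm fun z => ?_
    obtain ⟨a, b, h0, h1⟩ := exists_affine_interpolation hst (z s) (z t)
    obtain ⟨y, hy⟩ : ∃ y : V → ℝ, z = y + fun i => a + b * x i := ⟨_, (sub_add_cancel _ _).symm⟩
    have hinv : star z ⬝ᵥ (M *ᵥ z) = star y ⬝ᵥ (M *ᵥ y) := by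
      have hT : Mᵀ = M := hherm
      have horth : (fun i => a + b * x i) ⬝ᵥ (M *ᵥ y) = 0 := by
        rw [Matrix.dotProduct_mulVec, ← Matrix.mulVec_transpose, hT, hker, zero_dotProduct]
      rw [hy, Matrix.mulVec_add, hker, add_zero, star_trivial, star_trivial, add_dotProduct, horth,
        add_zero]
    have hy0 : 0 ≤ stressEnergy ω y := by
      rcases eq_or_ne y 0 with rfl | hne
      · simp [stressEnergy]
      · have hs := congrFun hy s
        have ht := congrFun hy t
        simp only [Pi.add_apply, h0, h1] at hs ht
        exact (hpos y (by linarith) (by linarith) hne).le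
    rw [← henergy] at hy0
    rw [hinv]
    linarith
  refine ⟨⟨ω, h, hpsd, ?_⟩, not_edgesOnConic_onLine huv hne⟩
  -- Evaluation at `s` and `t` identifies the kernel with `ℝ²`.
  let K := LinearMap.ker M.mulVecLin
  let ev : K →ₗ[ℝ] (Fin 2 → ℝ) :=
    LinearMap.pi ![(LinearMap.proj s).comp K.subtype, (LinearMap.proj t).comp K.subtype]
  have hinj : Function.Injective ev := by
    refine (injective_iff_map_eq_zero ev).2 fun z hz => ?_
    by_contra hne
    have hz0 : M *ᵥ z.1 = 0 := z.2
    have := hpos z.1 (congrFun hz 0) (congrFun hz 1) fun h => hne (Subtype.ext h)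
    rw [← henergy, hz0, dotProduct_zero, mul_zero] at this
    exact lt_irrefl _ this
  have hsurj : Function.Surjective ev := fun y => by
    obtain ⟨a, b, h0, h1⟩ := exists_affine_interpolation hst (y 0) (y 1)
    refine ⟨⟨fun i => a + b * x i, hker a b⟩, ?_⟩
    ext i
    fin_cases i
    · exact h0
    · exact h1
  have hK : Module.finrank ℝ K = 2 := by
    rw [(LinearEquiv.ofBijective ev ⟨hinj, hsurj⟩).finrank_eq, Module.finrank_fin_fun]
  have := M.mulVecLin.finrank_range_add_finrank_ker
  rwa [Module.finrank_fintype_fun_eq_card, hK] at this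

/-! ### Persistence of super stability -/

/-- A flow (an antisymmetric function on the oriented edges) that is conserved at each vertex. -/
structure IsCirculation (G : SimpleGraph V) (f : V → V → ℝ) : Prop where
  antisymm : ∀ i j, f j i = -f i j
  support : ∀ i j, ¬ G.Adj i j → f i j = 0
  conserved : ∀ i, ∑ j, f i j = 0

/-- The stress on the framework with coordinates `x` on the line whose edge forces are `f`. Where two
coordinates agree, in particular on the diagonal, its value is zero. -/
noncomputable def flowStress (f : V → V → ℝ) (x : V → ℝ) (i j : V) : ℝ := f i j / (x i - x j)

theorem isEquilibriumStress_flowStress {f : V → V → ℝ} (hf : IsCirculation G f)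
    {x : V → ℝ} (hx : Function.Injective x) :
    IsEquilibriumStress G (onLine x) (flowStress f x) where
  symm i j := by rw [flowStress, flowStress, hf.antisymm, ← neg_sub, neg_div_neg_eq]
  support i j hij := by rw [flowStress, hf.support i j hij, zero_div]
  equilibrium i := by
    ext k
    simp only [WithLp.ofLp_sum, Finset.sum_apply, PiLp.smul_apply, PiLp.sub_apply, smul_eq_mul,
      PiLp.zero_apply, onLine_apply]
    rw [← hf.conserved i]
    refine Finset.sum_congr rfl fun j _ => ?_
    by_cases hij : i = j
    · subst hij
      simp [hf.support i i (G.loopless.irrefl i)]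
    · exact div_mul_cancel₀ _ (sub_ne_zero.2 (hx.ne hij))

/-- A circulation gives an equilibrium stress that depends continuously on the configuration, and the
displacements to be tested are those on a compact unit sphere. So it certifies super stability of all
configurations near one at which the energy is positive. -/
theorem eventually_isSuperStable_onLine [DecidableEq V] {f : V → V → ℝ} (hf : IsCirculation G f)
    {x₀ : V → ℝ} (h₀ : Function.Injective x₀) {u v s t : V} (huv : G.Adj u v) (hst : s ≠ t)
    (hpos : ∀ z : V → ℝ, z s = 0 → z t = 0 → z ≠ 0 → 0 < stressEnergy (flowStress f x₀) z) :
    ∀ᶠ x in 𝓝 x₀, IsSuperStable G (onLine x) := by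
  let K : Set (V → ℝ) := {z | z s = 0 ∧ z t = 0} ∩ Metric.sphere 0 1
  have hK : IsCompact K :=
    (isCompact_sphere 0 1).inter_left ((isClosed_eq (continuous_apply s) continuous_const).inter
      (isClosed_eq (continuous_apply t) continuous_const))
  have hKpos : ∀ᶠ x in 𝓝 x₀, ∀ z ∈ K, 0 < stressEnergy (flowStress f x) z := by
    refine hK.eventually_forall_of_forall_eventually fun z hz => ?_
    have hz0 : z ≠ 0 := Metric.ne_of_mem_sphere hz.2 one_ne_zero
    have hcont : ContinuousAt (fun y : (V → ℝ) × (V → ℝ) => stressEnergy (flowStress f y.1) y.2)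
        (x₀, z) := by
      unfold stressEnergy flowStress
      refine tendsto_finsetSum _ fun i _ => tendsto_finsetSum _ fun j _ => ?_
      by_cases hij : i = j
      · subst hij
        simp
      · have hne : x₀ i - x₀ j ≠ 0 := sub_ne_zero.2 (h₀.ne hij)
        exact ContinuousAt.mul (ContinuousAt.div (by fun_prop) (by fun_prop) hne) (by fun_prop)
    exact continuousAt_const.eventually_lt hcont (hpos z hz.1.1 hz.1.2 hz0)
  filter_upwards [hKpos, eventually_sameOrder h₀] with x hx hord
  have hinj : Function.Injective x := hord.injective h₀
  refine (isEquilibriumStress_flowStress hf hinj).isSuperStable_onLine huv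
    (hinj.ne huv.ne) (hinj.ne hst) fun z hs ht hz => ?_
  have hn : 0 < ‖z‖ := norm_pos_iff.2 hz
  have h := hx (‖z‖⁻¹ • z) ⟨⟨by simp [hs], by simp [ht]⟩, by simp [norm_smul, hn.ne']⟩
  have hscale : stressEnergy (flowStress f x) (‖z‖⁻¹ • z)
      = ‖z‖⁻¹ ^ 2 * stressEnergy (flowStress f x) z := by
    simp only [stressEnergy, Finset.mul_sum, Pi.smul_apply, smul_eq_mul]
    exact Finset.sum_congr rfl fun i _ => Finset.sum_congr rfl fun j _ => by ring
  rw [hscale] at h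
  exact pos_of_mul_pos_right h (by positivity)

end Perturbation

/-! ### Prisms that are flexible in the plane -/

/-- If the curve through the points given by the rungs misses the line `a = b`, the prism has an
equivalent placement in the plane with its triangles on two lines, which are not parallel if `A + B ≠ 0`.
It is not congruent to the placement on the line: the distance of `(0, 0)` and `(1, 1)` has changed,
since these vertices do not give a point of the curve. -/
theorem not_isGloballyRigidIn_two_of_hyperbola {x : Fin 3 × Fin 2 → ℝ} {A B C S : ℝ}
    (hcurve : ∀ i, S + A * x (i, 0) - B * x (i, 1) + C * (x (i, 0) * x (i, 1)) = 0)
    (hdisc : (A - B) ^ 2 < 4 * S * C) (hAB : A + B ≠ 0)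
    (hoff : S + A * x (0, 0) - B * x (1, 1) + C * (x (0, 0) * x (1, 1)) ≠ 0) :
    ¬ IsGloballyRigidIn prism (onLine x) 2 := by
  have hC : C ≠ 0 := by
    rintro rfl
    nlinarith [sq_nonneg (A - B)]
  have hE : 0 < S * C + A * B := by nlinarith [sq_nonneg (A + B)]
  -- For an offset of squared length `2 l S` and inner products `l A`, `l B` with the unit vectors
  -- `e = (1, 0)` and `f`, where `e · f = 1 - l C`, the Gram determinant has to vanish in the plane.
  -- This fixes `l`.
  obtain ⟨l, hl⟩ : ∃ l, l = (4 * S * C - (A - B) ^ 2) / (2 * C * (S * C + A * B)) := ⟨_, rfl⟩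
  have hl0 : l ≠ 0 := hl ▸ div_ne_zero (by linarith) (by positivity)
  have hlE : l * (2 * C * (S * C + A * B)) = 4 * S * C - (A - B) ^ 2 := by
    rw [hl]; field_simp
  -- `f = (1 - l C, m)` is to be a unit vector that is not parallel to `e`.
  have hm : 0 < 1 - (1 - l * C) ^ 2 := by
    have h1 : 0 < l * C := by
      refine pos_of_mul_pos_left (b := 2 * (S * C + A * B)) ?_ (by linarith)
      linarith
    have h2 : 0 < 2 - l * C := by
      refine pos_of_mul_pos_left (b := 2 * (S * C + A * B)) ?_ (by linarith)
      have : 0 < (A + B) ^ 2 := by positivity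
      linarith
    nlinarith
  obtain ⟨m, hm0, hm2⟩ : ∃ m : ℝ, m ≠ 0 ∧ m ^ 2 = 1 - (1 - l * C) ^ 2 :=
    ⟨_, (Real.sqrt_pos.2 hm).ne', Real.sq_sqrt hm.le⟩
  -- The offset of the two lines is `(l A, w)`, with `w` determined by its inner product with `f`.
  obtain ⟨w, hw⟩ : ∃ w, w * m = l * (B - A * (1 - l * C)) := ⟨_, div_mul_cancel₀ _ hm0⟩
  have hnorm : (l * A) ^ 2 + w ^ 2 = 2 * l * S := by
    refine mul_right_cancel₀ (pow_ne_zero 2 hm0) ?_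
    have : w ^ 2 * m ^ 2 = (l * (B - A * (1 - l * C))) ^ 2 := by rw [← hw]; ring
    rw [add_mul, this, hm2]
    linear_combination l ^ 2 * hlE
  let q : Fin 3 × Fin 2 → Space 2 := fun v =>
    if v.2 = 0 then !₂[l * A + x v, w] else !₂[(1 - l * C) * x v, m * x v]
  have hdist0 (i j : Fin 3) : dist (q (i, 0)) (q (j, 0)) = |x (i, 0) - x (j, 0)| := by
    simp [q, EuclideanSpace.dist_eq, Real.dist_eq, Real.sqrt_sq_eq_abs]
  have hdist1 (i j : Fin 3) : dist (q (i, 1)) (q (j, 1)) = |x (i, 1) - x (j, 1)| := by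
    rw [← Real.sqrt_sq_eq_abs, EuclideanSpace.dist_eq]
    simp only [q, Real.dist_eq, sq_abs, Fin.sum_univ_two]
    congr 1
    simp
    linear_combination (x (i, 1) - x (j, 1)) ^ 2 * hm2
  have hdist01 (i j : Fin 3) : dist (q (i, 0)) (q (j, 1)) ^ 2 = (x (i, 0) - x (j, 1)) ^ 2 +
      2 * l * (S + A * x (i, 0) - B * x (j, 1) + C * (x (i, 0) * x (j, 1))) := by
    simp only [q, EuclideanSpace.dist_sq_eq, Real.dist_eq, sq_abs, Fin.sum_univ_two]
    simp
    linear_combination hnorm + x (j, 1) ^ 2 * hm2 - 2 * x (j, 1) * hw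
  intro hrigid
  have hcong := hrigid q ?_
  · have h := congrArg (· ^ 2) (hcong (0, 0) (1, 1))
    simp only [hdist01, dist_onLine, sq_abs] at h
    have : 2 * l * (S + A * x (0, 0) - B * x (1, 1) + C * (x (0, 0) * x (1, 1))) = 0 := by
      linarith
    simp_all
  · have hcross (i : Fin 3) : |x (i, 0) - x (i, 1)| = dist (q (i, 0)) (q (i, 1)) := by
      rw [← abs_of_nonneg (dist_nonneg (x := q (i, 0)) (y := q (i, 1))), ← sq_eq_sq_iff_abs_eq_abs,
        hdist01, hcurve, mul_zero, add_zero]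
    rintro ⟨i, k⟩ ⟨j, l⟩ hadj
    rw [dist_onLine]
    simp only [prism, SimpleGraph.boxProd_adj] at hadj
    fin_cases k <;> fin_cases l
    · exact (hdist0 i j).symm
    · obtain rfl : i = j := by simpa using hadj
      exact hcross i
    · obtain rfl : i = j := by simpa using hadj
      rw [abs_sub_comm, dist_comm]
      exact hcross i
    · exact (hdist1 i j).symm

/-- The coefficients `(S, A, B, C)` of the curve `S + A a - B b + C a b = 0` through the three points
`(aᵢ, bᵢ)` given by the rungs of the prism: the signed maximal minors of the matrix with rows
`(1, aᵢ, -bᵢ, aᵢ bᵢ)`. -/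
def rungCurve (x : Fin 3 × Fin 2 → ℝ) : Fin 4 → ℝ :=
  ![!![x (0, 0), -x (0, 1), x (0, 0) * x (0, 1); x (1, 0), -x (1, 1), x (1, 0) * x (1, 1);
      x (2, 0), -x (2, 1), x (2, 0) * x (2, 1)].det,
    -!![1, -x (0, 1), x (0, 0) * x (0, 1); 1, -x (1, 1), x (1, 0) * x (1, 1);
      1, -x (2, 1), x (2, 0) * x (2, 1)].det,
    !![1, x (0, 0), x (0, 0) * x (0, 1); 1, x (1, 0), x (1, 0) * x (1, 1);
      1, x (2, 0), x (2, 0) * x (2, 1)].det,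
    -!![1, x (0, 0), -x (0, 1); 1, x (1, 0), -x (1, 1); 1, x (2, 0), -x (2, 1)].det]

theorem continuous_rungCurve (k : Fin 4) : Continuous fun x => rungCurve x k := by
  fin_cases k <;> simp [rungCurve, Matrix.det_fin_three] <;> fun_prop

theorem rungCurve_rung (x : Fin 3 × Fin 2 → ℝ) (i : Fin 3) :
    rungCurve x 0 + rungCurve x 1 * x (i, 0) - rungCurve x 2 * x (i, 1)
      + rungCurve x 3 * (x (i, 0) * x (i, 1)) = 0 := by
  fin_cases i <;> simp [rungCurve, Matrix.det_fin_three] <;> ring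

theorem eventually_not_isGloballyRigidIn_two {x₀ : Fin 3 × Fin 2 → ℝ}
    (hdisc : (rungCurve x₀ 1 - rungCurve x₀ 2) ^ 2 < 4 * rungCurve x₀ 0 * rungCurve x₀ 3)
    (hAB : rungCurve x₀ 1 + rungCurve x₀ 2 ≠ 0)
    (hoff : rungCurve x₀ 0 + rungCurve x₀ 1 * x₀ (0, 0) - rungCurve x₀ 2 * x₀ (1, 1)
      + rungCurve x₀ 3 * (x₀ (0, 0) * x₀ (1, 1)) ≠ 0) :
    ∀ᶠ x in 𝓝 x₀, ¬ IsGloballyRigidIn prism (onLine x) 2 := by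
  have c0 := continuous_rungCurve 0
  have c1 := continuous_rungCurve 1
  have c2 := continuous_rungCurve 2
  have c3 := continuous_rungCurve 3
  have e1 : ∀ᶠ x in 𝓝 x₀,
      (rungCurve x 1 - rungCurve x 2) ^ 2 < 4 * rungCurve x 0 * rungCurve x 3 :=
    ((c1.sub c2).pow 2).continuousAt.eventually_lt
      ((continuous_const.mul c0).mul c3).continuousAt hdisc
  have e2 : ∀ᶠ x in 𝓝 x₀, rungCurve x 1 + rungCurve x 2 ≠ 0 :=
    (c1.add c2).continuousAt.eventually_ne hAB
  have e3 : ∀ᶠ x in 𝓝 x₀, rungCurve x 0 + rungCurve x 1 * x (0, 0) - rungCurve x 2 * x (1, 1)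
      + rungCurve x 3 * (x (0, 0) * x (1, 1)) ≠ 0 :=
    Continuous.continuousAt (by fun_prop) |>.eventually_ne hoff
  filter_upwards [e1, e2, e3] with x h1 h2 h3
  exact not_isGloballyRigidIn_two_of_hyperbola (rungCurve_rung x) h1 h2 h3

/-! ### A super stable prism -/

/-- A circulation on the prism, chosen so that its stress has positive energy at the configuration of
`stressEnergy_prismFlow_pos`. -/
def prismFlow (u v : Fin 3 × Fin 2) : ℝ :=
  if u.2 = 0 then
    if v.2 = 0 then !![0, -3, 4; 3, 0, -5; -4, 5, 0] u.1 v.1 else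
      Matrix.diagonal ![-1, 2, -1] u.1 v.1
  else
    if v.2 = 0 then Matrix.diagonal ![1, -2, 1] u.1 v.1 else
      !![0, -6, 5; 6, 0, -4; -5, 4, 0] u.1 v.1

theorem isCirculation_prismFlow : IsCirculation prism prismFlow where
  antisymm := by
    rintro ⟨i, k⟩ ⟨j, l⟩
    fin_cases k <;> fin_cases l <;> fin_cases i <;> fin_cases j <;> simp [prismFlow]
  support := by
    rintro ⟨i, k⟩ ⟨j, l⟩
    fin_cases k <;> fin_cases l <;> fin_cases i <;> fin_cases j <;> simp [prismFlow, prism]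
  conserved := by
    rintro ⟨i, k⟩
    fin_cases k <;> fin_cases i <;>
      simp [prismFlow, Fintype.sum_prod_type, Fin.sum_univ_succ] <;> norm_num

/-- The configuration whose two triangles have coordinates `a` and `b`. -/
def prismCoord (a b : Fin 3 → ℝ) (v : Fin 3 × Fin 2) : ℝ := if v.2 = 0 then a v.1 else b v.1

theorem stressEnergy_prismFlow_pos (z : Fin 3 × Fin 2 → ℝ) (h0 : z (0, 0) = 0) (h1 : z (2, 1) = 0)
    (hz : z ≠ 0) :
    0 < stressEnergy (flowStress prismFlow (prismCoord ![0, 2, 6] ![1, 5, 7])) z := by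
  have hsos : stressEnergy (flowStress prismFlow (prismCoord ![0, 2, 6] ![1, 5, 7])) z =
      5 / 2 * (z (1, 0) - z (2, 0)) ^ 2 + 3 * (z (0, 1) - z (1, 1)) ^ 2
        + 4 / 3 * (z (1, 0) + z (1, 1)) ^ 2 + 1 / 3 * z (1, 0) ^ 2 + 2 / 3 * z (2, 0) ^ 2
        + 1 / 3 * z (0, 1) ^ 2 + 4 / 3 * z (1, 1) ^ 2 := by
    simp [stressEnergy, flowStress, prismFlow, prismCoord, Fintype.sum_prod_type,
      Fin.sum_univ_succ, h0, h1]
    ring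
  obtain ⟨v, hv⟩ : ∃ v, z v ≠ 0 := Function.ne_iff.1 hz
  have hv := pow_pos (abs_pos.2 hv) 2
  rw [sq_abs] at hv
  rw [hsos]
  rcases v with ⟨i, k⟩
  fin_cases k <;> fin_cases i <;>
    simp only [Fin.zero_eta, Fin.mk_one, Fin.reduceFinMk, h0, h1, ne_eq, OfNat.ofNat_ne_zero,
      not_false_eq_true, zero_pow, lt_self_iff_false] at hv <;> positivity

/-! ### Two generic prisms with the same vertex order -/

theorem sameOrder_prismCoord : SameOrder (onLine (prismCoord ![0, 2, 6] ![1, 5, 7]))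
    (onLine (prismCoord ![-6, 0, 6] ![-2, 3, 18])) := by
  rintro ⟨i, k⟩ ⟨j, l⟩
  fin_cases k <;> fin_cases l <;> fin_cases i <;> fin_cases j <;> simp [prismCoord] <;> norm_num

theorem injective_prismCoord : Function.Injective (prismCoord ![-6, 0, 6] ![-2, 3, 18]) := by
  rintro ⟨i, k⟩ ⟨j, l⟩
  fin_cases k <;> fin_cases l <;> fin_cases i <;> fin_cases j <;> simp [prismCoord] <;> norm_num

theorem exists_generic_prism_sameOrder : ∃ p q : Fin 3 × Fin 2 → Space 1,
    IsGeneric p ∧ IsGeneric q ∧ SameOrder p q ∧ IsSuperStable prism p ∧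
      ¬ IsGloballyRigidIn prism q 2 := by
  have hy₀ := injective_prismCoord
  have hx₀ := sameOrder_prismCoord.injective hy₀
  have hstable := eventually_isSuperStable_onLine isCirculation_prismFlow hx₀
    (u := (0, 0)) (v := (0, 1)) (s := (0, 0)) (t := (2, 1)) (by simp [prism]) (by decide)
    stressEnergy_prismFlow_pos
  have hflex : ∀ᶠ x in 𝓝 (prismCoord ![-6, 0, 6] ![-2, 3, 18]),
      ¬ IsGloballyRigidIn prism (onLine x) 2 := by
    refine eventually_not_isGloballyRigidIn_two ?_ ?_ ?_ <;>
      simp [rungCurve, Matrix.det_fin_three, prismCoord] <;> norm_num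
  obtain ⟨x, hx, hxs, hxo⟩ := ((mem_closure_iff_frequently.1
    (dense_algebraicIndependent _ _)).and_eventually
      (hstable.and (eventually_sameOrder hx₀))).exists
  obtain ⟨y, hy, hyf, hyo⟩ := ((mem_closure_iff_frequently.1
    (dense_algebraicIndependent _ _)).and_eventually
      (hflex.and (eventually_sameOrder hy₀))).exists
  exact ⟨onLine x, onLine y, isGeneric_onLine hx, isGeneric_onLine hy,
    fun u v => ((hxo u v).trans (sameOrder_prismCoord u v)).trans (hyo u v).symm, hxs, hyf⟩
end BarJoint

theorem mainTheorem1 :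
    -- the two generic frameworks of the prism
    (∃ p q : Fin 3 × Fin 2 → BarJoint.Space 1,
      BarJoint.IsGeneric p ∧ BarJoint.IsGeneric q ∧ BarJoint.SameOrder p q ∧
      BarJoint.IsSuperStable BarJoint.prism p ∧
      BarJoint.IsUniversallyRigid BarJoint.prism p ∧
      ¬ BarJoint.IsGloballyRigidIn BarJoint.prism q 2 ∧
      ¬ BarJoint.IsUniversallyRigid BarJoint.prism q ∧
      ¬ BarJoint.IsSuperStable BarJoint.prism q) ∧
    -- the vertex order does not determine universal rigidity of generic frameworks of the prism
    (¬ ∀ p q : Fin 3 × Fin 2 → BarJoint.Space 1,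
      BarJoint.IsGeneric p → BarJoint.IsGeneric q → BarJoint.SameOrder p q →
      (BarJoint.IsUniversallyRigid BarJoint.prism p ↔
        BarJoint.IsUniversallyRigid BarJoint.prism q)) ∧
    -- nor does it determine their super stability
    (¬ ∀ p q : Fin 3 × Fin 2 → BarJoint.Space 1,
      BarJoint.IsGeneric p → BarJoint.IsGeneric q → BarJoint.SameOrder p q →
      (BarJoint.IsSuperStable BarJoint.prism p ↔
        BarJoint.IsSuperStable BarJoint.prism q)) ∧
    -- the question about frameworks in general position on the line has a negative answer
    (¬ ∀ (V : Type) [Fintype V] (G : SimpleGraph V) (p q : V → BarJoint.Space 1),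
      BarJoint.IsGeneralPosition p → BarJoint.IsGeneralPosition q → BarJoint.SameOrder p q →
      (BarJoint.IsUniversallyRigid G p ↔ BarJoint.IsUniversallyRigid G q)) := by
  obtain ⟨p, q, hp, hq, hpq, hstable, hflex⟩ := BarJoint.exists_generic_prism_sameOrder
  have hrigid := hstable.isUniversallyRigid
  have hflexible : ¬ BarJoint.IsUniversallyRigid BarJoint.prism q := fun h => hflex (h 2 one_le_two)
  have hunstable : ¬ BarJoint.IsSuperStable BarJoint.prism q :=
    fun h => hflexible h.isUniversallyRigid
  exact ⟨⟨p, q, hp, hq, hpq, hstable, hrigid, hflex, hflexible, hunstable⟩,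
    fun h => hflexible ((h p q hp hq hpq).1 hrigid),
    fun h => hunstable ((h p q hp hq hpq).1 hstable),
    fun h => hflexible ((h _ _ p q hp.isGeneralPosition hq.isGeneralPosition hpq).1 hrigid)⟩
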